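/- Theorem 4.1. Let $K$ be a field of characteristic $0$, let $d \ge 0$ be an integer, and let $A = K[x_1,\dots,x_d]$. Let $\sigma : A \to A$ be a $K$-algebra automorphism, and let $I$ and $J$ be ideals of $A$. Then the set $$\{\, n \in \mathbb{Z} : \sigma^n(I) \supseteq J \,\}, \qquad \sigma^n(I) := \{\sigma^n(a) : a \in I\},$$ has the two-sided SML property: it is the union of finitely many complete arithmetic progressions $\{an+b : n \in \mathbb{Z}\}$ (with $a, b \in \mathbb{Z}$, where $a = 0$ is allowed and gives the one-element set $\{b\}$) and a finite set. -/

import Mathlib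

/-- The complete (doubly infinite) arithmetic progression `{a * n + b : n ∈ ℤ}`.
The common difference `a` may be `0`, which gives the one-element set `{b}`. -/
def completeAP (a b : ℤ) : Set ℤ :=
  {m : ℤ | ∃ n : ℤ, m = a * n + b}

/-- A set of integers has the two-sided SML property if it is a finite union of complete
arithmetic progressions together with a finite set. Both the family of progressions and the
finite set may be empty. -/
def TwoSidedSML (S : Set ℤ) : Prop :=
  ∃ (P : Finset (ℤ × ℤ)) (F : Finset ℤ),
    S = (⋃ q ∈ P, completeAP q.1 q.2) ∪ (F : Set ℤ)

/-! This is a `p`-adic argument of Skolem–Mahler–Lech type. Since `σ^n(I) ⊇ J` means that `σ^(-n) f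
∈ I` for each of finitely many generators `f` of `J`, a primary decomposition of `I` reduces the
claim to `{n | σ^n f ∈ Q}` with `Q` primary. The property proved for these sets is
`FiniteOrFullModulo`; it survives finite intersections and `n ↦ -n`, and it implies the SML
property.

Only a finitely generated `σ`-stable subring matters. Its image modulo `Q` spans a finitely
generated `ℚ`-algebra with primary zero ideal, which Noether normalization and the regular
representation embed into matrices over `ℚ(x₁,…,x_r)` (`exists_injective_matrix`). For a suitable
odd `p` the entries embed into `ℤ_p` (`exists_padic_embedding`).

The elements that vanish modulo `p` form an ideal of finite index, so a power `τ` of `σ` is trivial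
modulo its square. Then `(τ - 1)^k g` is divisible by `p^k`, and `τ^n g = ∑ (n choose k) (τ - 1)^k
g` has Newton series as entries. By `newtonSeries_eq_zero_of_infinite` each entry vanishes
identically or has finitely many zeros. -/

/-! ### Zeros of `p`-adic Newton series -/

open Polynomial in
/-- The divided difference of a family of integers `P(i)`, `i ∈ s`, for an integer polynomial `P`
is an integer, which is determined when `P` is monic of degree less than `#s`. -/
theorem exists_int_dividedDifference (F : Type*) [Field F] [CharZero F] (s : Finset ℕ)
    (hs : s.Nonempty) (P : ℤ[X]) :
    ∃ w : ℤ, ∑ i ∈ s, ((P.eval (i : ℤ) : ℤ) : F) / ∏ j ∈ s.erase i, ((i : F) - j) = w ∧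
      (P.natDegree < s.card → w = P.coeff (s.card - 1)) := by
  set W : ℤ[X] := ∏ i ∈ s, (X - C (i : ℤ)) with hW
  have hWm : W.Monic := monic_prod_of_monic _ _ fun i _ => monic_X_sub_C _
  have hWd : W.natDegree = s.card := by
    rw [hW, natDegree_prod_of_monic _ _ fun i _ => monic_X_sub_C _]
    simp only [natDegree_X_sub_C, Finset.sum_const, smul_eq_mul, mul_one]
  have hcard : 0 < s.card := hs.card_pos
  -- The divided difference is the top coefficient of the interpolating polynomial, which is `P %ₘ
  -- W`; it is integral because `W` is monic over `ℤ`.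
  refine ⟨(P %ₘ W).coeff (s.card - 1), ?_, ?_⟩
  · have hdeg : ((P %ₘ W).map (Int.castRingHom F)).degree < s.card := by
      refine lt_of_le_of_lt degree_map_le ?_
      rw [← hWd, ← degree_eq_natDegree hWm.ne_zero]
      exact degree_modByMonic_lt _ hWm
    have := Lagrange.coeff_eq_sum (s := s) (v := fun i : ℕ => (i : F))
      (fun a _ b _ h => Nat.cast_injective h) hdeg
    rw [coeff_map] at this
    simp only [eq_intCast] at this
    rw [this]
    refine Finset.sum_congr rfl fun i hi => ?_
    congr 1
    have h0 : W.eval (i : ℤ) = 0 := by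
      rw [hW, eval_prod]
      exact Finset.prod_eq_zero hi (by simp)
    have h1 : P.eval (i : ℤ) = (P %ₘ W).eval (i : ℤ) := by
      conv_lhs => rw [← modByMonic_add_div P W]
      simp [h0]
    rw [h1, ← Int.cast_natCast (R := F) i, eval_intCast_map]
    simp
  · intro h
    rw [(modByMonic_eq_self_iff hWm).2]
    rw [degree_eq_natDegree hWm.ne_zero, hWd]
    exact lt_of_le_of_lt degree_le_natDegree (by exact_mod_cast h)

/-- Strassman's theorem for Newton series: `∑ e k * n (n - 1) ⋯ (n - k + 1)` with `e k → 0`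
has finitely many natural zeros unless all `e k` vanish. -/
theorem newtonSeries_eq_zero_of_infinite (p : ℕ) [Fact p.Prime] (u e : ℕ → ℚ_[p])
    (he : Filter.Tendsto e Filter.atTop (nhds 0))
    (hu : ∀ n T, n < T → u n = ∑ k ∈ Finset.range T, e k * (n.descFactorial k : ℚ_[p]))
    (hinf : {n | u n = 0}.Infinite) (k₀ : ℕ) : e k₀ = 0 := by
  classical
  by_contra hk₀
  have hfin : {k | ‖e k₀‖ ≤ ‖e k‖}.Finite := by
    have h1 : ∀ᶠ k in Filter.atTop, ‖e k‖ < ‖e k₀‖ :=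
      (tendsto_zero_iff_norm_tendsto_zero.1 he).eventually_lt_const (norm_pos_iff.2 hk₀)
    rw [← Nat.cofinite_eq_atTop, Filter.eventually_cofinite] at h1
    simpa using h1
  obtain ⟨M, hM, hMmax⟩ := Finset.exists_max_image hfin.toFinset (fun k => ‖e k‖)
    ⟨k₀, by simp⟩
  simp only [Set.Finite.mem_toFinset, Set.mem_ofPred_eq] at hM hMmax
  have hMmax' : ∀ k, ‖e k‖ ≤ ‖e M‖ := fun k => by
    by_cases h : ‖e k₀‖ ≤ ‖e k‖
    · exact hMmax k h
    · exact (not_le.1 h).le.trans hM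
  -- As in Strassman's theorem, `K` is the last index at which `‖e k‖` is maximal.
  obtain ⟨K, hK, hKmax⟩ := Finset.exists_max_image
    (hfin.toFinset.filter fun k => ‖e k‖ = ‖e M‖) id ⟨M, by simpa using hM⟩
  simp only [Finset.mem_filter, Set.Finite.mem_toFinset, Set.mem_ofPred_eq, id] at hK hKmax
  have hlast : ∀ k, K < k → ‖e k‖ < ‖e K‖ := fun k hk => by
    rw [hK.2]
    refine lt_of_le_of_ne (hMmax' k) fun h => ?_
    exact absurd (hKmax k ⟨h ▸ hM, h⟩) (not_le.2 hk)
  have hKpos : 0 < ‖e K‖ := (norm_pos_iff.2 hk₀).trans_le hK.1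
  -- A divided difference over `K + 1` zeros kills the terms with `k < K`, takes the value `e K` at
  -- `k = K`, and multiplies later terms by integers. So `e K` would cancel against strictly smaller
  -- terms, which the ultrametric inequality forbids.
  obtain ⟨s, hs, hcard⟩ := hinf.exists_subset_card_eq (K + 1)
  have hsne : s.Nonempty := Finset.card_pos.1 (by omega)
  choose w hw hw' using fun k =>
    exists_int_dividedDifference ℚ_[p] s hsne (descPochhammer ℤ k)
  obtain ⟨T, hT⟩ : ∃ T, ∀ i ∈ insert K s, i < T :=
    ⟨(insert K s).sup id + 1, fun i hi => Nat.lt_succ_of_le (Finset.le_sup (f := id) hi)⟩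
  have hsum : ∑ k ∈ Finset.range T, e k * (w k : ℚ_[p]) = 0 := by
    have h0 : ∑ i ∈ s, u i / ∏ j ∈ s.erase i, ((i : ℚ_[p]) - j) = 0 :=
      Finset.sum_eq_zero fun i hi => by rw [show u i = 0 from hs hi, zero_div]
    rw [← h0]
    simp_rw [← hw, Finset.mul_sum]
    rw [Finset.sum_comm]
    refine Finset.sum_congr rfl fun i hi => ?_
    rw [hu i T (hT i (Finset.mem_insert_of_mem hi)), Finset.sum_div]
    refine Finset.sum_congr rfl fun k _ => ?_
    rw [descPochhammer_eval_eq_descFactorial, mul_div_assoc]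
    simp
  have hwK : w K = 1 := by
    rw [hw' K (by rw [descPochhammer_natDegree]; omega), hcard]
    have := (monic_descPochhammer ℤ K).coeff_natDegree
    rwa [descPochhammer_natDegree] at this
  have hwlt : ∀ k < K, w k = 0 := fun k hk => by
    rw [hw' k (by rw [descPochhammer_natDegree]; omega), hcard]
    exact Polynomial.coeff_eq_zero_of_natDegree_lt (by rw [descPochhammer_natDegree]; omega)
  rw [← Finset.add_sum_erase _ _ (Finset.mem_range.2 (hT K (Finset.mem_insert_self _ _))), hwK,
    Int.cast_one, mul_one] at hsum
  have hlt : ‖∑ k ∈ (Finset.range T).erase K, e k * (w k : ℚ_[p])‖ < ‖e K‖ := by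
    by_cases hne : ((Finset.range T).erase K).Nonempty
    · obtain ⟨k, hk, hle⟩ := IsUltrametricDist.exists_norm_finsetSum_le_of_nonempty hne
        (fun k => e k * (w k : ℚ_[p]))
      refine hle.trans_lt ?_
      rcases lt_or_gt_of_ne (Finset.ne_of_mem_erase hk) with h | h
      · simpa [hwlt k h] using hKpos
      · rw [norm_mul]
        exact (mul_le_of_le_one_right (norm_nonneg _) (Padic.norm_int_le_one _)).trans_lt
          (hlast k h)
    · rw [Finset.not_nonempty_iff_eq_empty.1 hne]
      simpa using hKpos
  rw [eq_neg_of_add_eq_zero_left hsum, norm_neg] at hlt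
  exact lt_irrefl _ hlt

theorem tendsto_div_factorial_of_norm_le (p : ℕ) [Fact p.Prime] (hp : p ≠ 2) (c : ℕ → ℚ_[p])
    (hc : ∀ k, ‖c k‖ ≤ (p : ℝ) ^ (-(k : ℤ))) :
    Filter.Tendsto (fun k => c k / (k.factorial : ℚ_[p])) Filter.atTop (nhds 0) := by
  have hp1 : 1 < p := (Fact.out : p.Prime).one_lt
  have hp1' : (1 : ℝ) < p := by exact_mod_cast hp1
  have hdiv : Filter.Tendsto (fun k : ℕ => k / 2) Filter.atTop Filter.atTop :=
    Filter.tendsto_atTop.2 fun b => Filter.eventually_atTop.2 ⟨2 * b, fun a ha => by omega⟩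
  refine squeeze_zero_norm (a := fun k : ℕ => ((p : ℝ)⁻¹) ^ (k / 2)) (fun k => ?_)
    ((tendsto_pow_atTop_nhds_zero_of_lt_one (by positivity) (inv_lt_one_of_one_lt₀ hp1')).comp
      hdiv)
  have hf : ‖(k.factorial : ℚ_[p])‖ = (p : ℝ) ^ (-(padicValNat p k.factorial : ℤ)) := by
    rw [Padic.norm_eq_zpow_neg_valuation (by exact_mod_cast k.factorial_ne_zero),
      Padic.valuation_natCast]
  -- Legendre's formula bounds `(p - 1) * v_p(k!)` by `k`, and `p - 1 ≥ 2` as `p` is odd.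
  have hv : 2 * padicValNat p k.factorial ≤ k := by
    have h := sub_one_mul_padicValNat_factorial (p := p) k
    have h2 : 2 * padicValNat p k.factorial ≤ (p - 1) * padicValNat p k.factorial :=
      Nat.mul_le_mul_right _ (by omega)
    omega
  rw [norm_div, hf, inv_pow, ← zpow_natCast, ← zpow_neg]
  calc ‖c k‖ / (p : ℝ) ^ (-(padicValNat p k.factorial : ℤ))
      ≤ (p : ℝ) ^ (-(k : ℤ)) / (p : ℝ) ^ (-(padicValNat p k.factorial : ℤ)) := by
        gcongr; exact hc k
    _ = (p : ℝ) ^ (-(k : ℤ) - -(padicValNat p k.factorial : ℤ)) := by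
        rw [← zpow_sub₀ (by positivity)]
    _ ≤ _ := zpow_le_zpow_right₀ hp1'.le (by omega)

/-- If `u n = ∑ (n choose k) c k` with `c k ∈ p ^ k ℤ_p` vanishes infinitely often, then it
vanishes identically. -/
theorem eq_zero_of_infinite_zeros (p : ℕ) [Fact p.Prime] (hp : p ≠ 2) (u c : ℕ → ℚ_[p])
    (hc : ∀ k, ‖c k‖ ≤ (p : ℝ) ^ (-(k : ℤ)))
    (hu : ∀ n, u n = ∑ k ∈ Finset.range (n + 1), c k * (n.choose k : ℚ_[p]))
    (hinf : {n | u n = 0}.Infinite) (n : ℕ) : u n = 0 := by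
  have h := newtonSeries_eq_zero_of_infinite p u (fun k => c k / (k.factorial : ℚ_[p]))
    (tendsto_div_factorial_of_norm_le p hp c hc) (fun n T hT => ?_) hinf
  · rw [hu]
    refine Finset.sum_eq_zero fun k _ => ?_
    have := h k
    rw [div_eq_zero_iff, or_iff_left (by exact_mod_cast k.factorial_ne_zero)] at this
    rw [this, zero_mul]
  · rw [hu]
    have h1 : ∀ k, c k / (k.factorial : ℚ_[p]) * (n.descFactorial k : ℚ_[p]) =
        c k * (n.choose k : ℚ_[p]) := fun k => by
      have : (k.factorial : ℚ_[p]) ≠ 0 := by exact_mod_cast k.factorial_ne_zero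
      rw [Nat.descFactorial_eq_factorial_mul_choose]
      push_cast
      field_simp
    simp_rw [h1]
    refine Finset.sum_subset (Finset.range_subset_range.2 hT) fun k _ hk => ?_
    rw [Nat.choose_eq_zero_of_lt (by simpa using hk)]
    simp

/-! ### Orbits in matrix rings over `ℤ_p` -/

/-- If `τ` is congruent to the identity modulo `I ^ 2`, then `τ - 1` raises the `I`-adic order. -/
theorem sub_mem_pow_succ_of_sub_mem_sq {A : Type*} [CommRing A] (I : Ideal A) (τ : A →+* A)
    (h : ∀ a, τ a - a ∈ I ^ 2) (k : ℕ) : ∀ a ∈ I ^ k, τ a - a ∈ I ^ (k + 1) := by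
  have hI : ∀ a ∈ I, τ a ∈ I := fun a ha => by
    have := I.add_mem (Ideal.pow_le_self two_ne_zero (h a)) ha
    simpa using this
  induction k with
  | zero => exact fun a _ => Ideal.pow_le_pow_right (by norm_num) (h a)
  | succ k ih =>
    intro a ha
    rw [pow_succ'] at ha
    refine Submodule.mul_induction_on ha (fun x hx y hy => ?_) fun x y hx hy => ?_
    · have h1 : τ (x * y) - x * y = τ x * (τ y - y) + (τ x - x) * y := by rw [map_mul]; ring
      rw [h1]
      refine Ideal.add_mem _ ?_ ?_
      · rw [pow_succ']
        exact Ideal.mul_mem_mul (hI x hx) (ih y hy)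
      · rw [show k + 1 + 1 = 2 + k by ring, pow_add]
        exact Ideal.mul_mem_mul (h x) hy
    · rw [map_add, add_sub_add_comm]
      exact Ideal.add_mem _ hx hy

/-- The ideal of elements whose image in the matrix ring vanishes modulo `p`. -/
noncomputable def matrixResidueIdeal {A : Type*} [CommRing A] {p : ℕ} [Fact p.Prime] {m : ℕ}
    (ψ : A →+* Matrix (Fin m) (Fin m) ℤ_[p]) : Ideal A :=
  RingHom.ker ((PadicInt.toZMod (p := p)).mapMatrix.comp ψ)

theorem dvd_of_mem_matrixResidueIdeal_pow {A : Type*} [CommRing A] {p : ℕ} [Fact p.Prime] {m : ℕ}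
    (ψ : A →+* Matrix (Fin m) (Fin m) ℤ_[p]) (k : ℕ) :
    ∀ a ∈ matrixResidueIdeal ψ ^ k, ∀ i j, (p : ℤ_[p]) ^ k ∣ ψ a i j := by
  induction k with
  | zero => simp
  | succ k ih =>
    intro a ha
    rw [pow_succ'] at ha
    refine Submodule.mul_induction_on ha (fun x hx y hy i j => ?_) fun x y hx hy i j => ?_
    · rw [map_mul, Matrix.mul_apply, pow_succ']
      refine Finset.dvd_sum fun l _ => mul_dvd_mul ?_ (ih y hy l j)
      have h1 : (PadicInt.toZMod (p := p)).mapMatrix (ψ x) = 0 := hx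
      have h2 : PadicInt.toZMod (ψ x i l) = 0 := congrFun (congrFun h1 i) l
      rw [← RingHom.mem_ker, PadicInt.ker_toZMod, PadicInt.maximalIdeal_eq_span_p,
        Ideal.mem_span_singleton] at h2
      exact h2
    · rw [map_add]
      exact dvd_add (hx i j) (hy i j)

/-- Expanding `τ^n = (1 + δ)^n` binomially makes each matrix entry a Newton series whose `k`-th
coefficient is divisible by `p^k`. -/
theorem matrix_orbit_eq_zero_of_infinite {A : Type*} [CommRing A] {p : ℕ} [Fact p.Prime]
    (hp : p ≠ 2) {m : ℕ} (ψ : A →+* Matrix (Fin m) (Fin m) ℤ_[p]) (τ : A →+* A)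
    (hτ : ∀ a, τ a - a ∈ matrixResidueIdeal ψ ^ 2) (g : A)
    (hinf : {n : ℕ | ψ ((τ ^ n) g) = 0}.Infinite) (n : ℕ) : ψ ((τ ^ n) g) = 0 := by
  let T : Module.End ℤ A := (τ : A →+ A).toIntLinearMap
  let δ : Module.End ℤ A := T - 1
  have hmem : ∀ k, (δ ^ k) g ∈ matrixResidueIdeal ψ ^ k := by
    intro k
    induction k with
    | zero => simp
    | succ k ih =>
      rw [pow_succ' δ]
      exact sub_mem_pow_succ_of_sub_mem_sq _ τ hτ k _ ih
  have hiter : ∀ n : ℕ, (τ ^ n) g = ∑ k ∈ Finset.range (n + 1), (n.choose k) • (δ ^ k) g := by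
    intro n
    have h1 : (τ ^ n) g = (T ^ n) g := by
      rw [RingHom.coe_pow, Module.End.coe_pow]; rfl
    have h2 : T = δ + 1 := (sub_add_cancel T 1).symm
    rw [h1, h2, (Commute.one_right δ).add_pow, LinearMap.sum_apply]
    refine Finset.sum_congr rfl fun k _ => ?_
    rw [one_pow, mul_one, ← nsmul_eq_mul']
    rfl
  ext i j
  have key := eq_zero_of_infinite_zeros p hp (fun n => (ψ ((τ ^ n) g) i j : ℚ_[p]))
    (fun k => (ψ ((δ ^ k) g) i j : ℚ_[p])) (fun k => ?_) (fun n => ?_)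
    (hinf.mono fun n (hn : ψ ((τ ^ n) g) = 0) => by
      change ((ψ ((τ ^ n) g) i j : ℤ_[p]) : ℚ_[p]) = 0
      rw [hn]; simp) n
  · simpa using key
  · have h1 := dvd_of_mem_matrixResidueIdeal_pow ψ k _ (hmem k) i j
    rw [← PadicInt.norm_def, PadicInt.norm_le_pow_iff_mem_span_pow]
    exact Ideal.mem_span_singleton.2 h1
  · rw [hiter n, map_sum, Matrix.sum_apply, PadicInt.coe_sum]
    refine Finset.sum_congr rfl fun k _ => ?_
    rw [map_nsmul, Matrix.smul_apply, nsmul_eq_mul, PadicInt.coe_mul, PadicInt.coe_natCast, mul_comm]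

theorem finite_quotient_matrixResidueIdeal {A : Type*} [CommRing A] {p : ℕ} [Fact p.Prime] {m : ℕ}
    (ψ : A →+* Matrix (Fin m) (Fin m) ℤ_[p]) : Finite (A ⧸ matrixResidueIdeal ψ) :=
  Finite.of_injective _
    (RingHom.kerLift_injective ((PadicInt.toZMod (p := p)).mapMatrix.comp ψ))

theorem finite_ringHom_of_finiteType (A B : Type*) [CommRing A] [CommRing B] [Finite B]
    [Algebra.FiniteType ℤ A] : Finite (A →+* B) := by
  obtain ⟨s, hs⟩ := (Algebra.FiniteType.out : (⊤ : Subalgebra ℤ A).FG)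
  refine Finite.of_injective (fun f : A →+* B => fun x : s => f x) fun f g h => ?_
  have : f.toIntAlgHom = g.toIntAlgHom :=
    AlgHom.ext_of_adjoin_eq_top hs fun x hx => congrFun h ⟨x, hx⟩
  exact RingHom.ext fun x => DFunLike.congr_fun this x

/-- Some positive power of an automorphism of a finitely generated ring acts trivially modulo a
given ideal of finite index. -/
theorem exists_pow_sub_mem {A : Type*} [CommRing A] [Algebra.FiniteType ℤ A] (σ : A ≃+* A)
    (I : Ideal A) [Finite (A ⧸ I)] : ∃ N : ℕ, 0 < N ∧ ∀ a, (σ ^ N) a - a ∈ I := by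
  have := finite_ringHom_of_finiteType A (A ⧸ I)
  -- Pigeonhole: there are only finitely many ring homomorphisms `A →+* A ⧸ I`.
  obtain ⟨i, j, hij, h⟩ := Finite.exists_ne_map_eq_of_infinite
    (fun n : ℕ => (Ideal.Quotient.mk I).comp ((σ ^ n : A ≃+* A) : A →+* A))
  wlog hlt : i < j generalizing i j
  · exact this j i hij.symm h.symm (by omega)
  refine ⟨j - i, by omega, fun a => ?_⟩
  have h1 := DFunLike.congr_fun h ((σ ^ i)⁻¹ a)
  simp only [RingHom.comp_apply, RingHom.coe_coe] at h1
  rw [show j = (j - i) + i by omega, pow_add, RingAut.mul_apply, RingAut.inv_apply, RingEquiv.apply_symm_apply] at h1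
  exact Ideal.Quotient.eq.1 h1.symm

/-- A set of integers that, along the residue classes modulo some `N > 0`, is finite or
everything. -/
def FiniteOrFullModulo (S : Set ℤ) : Prop :=
  ∃ N : ℕ, 0 < N ∧ ∀ r : ℤ,
    {n : ℤ | r + N * n ∈ S}.Finite ∨ {n : ℤ | r + N * n ∈ S} = Set.univ

theorem finiteOrFullModulo_of_matrix_padicInt {A : Type*} [CommRing A] [Algebra.FiniteType ℤ A]
    {p : ℕ} [Fact p.Prime] (hp : p ≠ 2) {m : ℕ} (ψ : A →+* Matrix (Fin m) (Fin m) ℤ_[p])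
    (σ : A ≃+* A) (f : A) : FiniteOrFullModulo {n : ℤ | ψ ((σ ^ n) f) = 0} := by
  have : Finite (A ⧸ matrixResidueIdeal ψ) := finite_quotient_matrixResidueIdeal ψ
  have : IsNoetherianRing A := Algebra.FiniteType.isNoetherianRing ℤ A
  have : Finite (A ⧸ matrixResidueIdeal ψ ^ 2) :=
    Ideal.finite_quotient_pow (IsNoetherian.noetherian _) 2
  obtain ⟨N, hN, hτ⟩ := exists_pow_sub_mem σ (matrixResidueIdeal ψ ^ 2)
  set τ : A ≃+* A := σ ^ N with hτdef
  have hτ' : ∀ a, τ⁻¹ a - a ∈ matrixResidueIdeal ψ ^ 2 := fun a => by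
    have := hτ (τ⁻¹ a)
    rw [RingAut.inv_apply, RingEquiv.apply_symm_apply] at this
    rw [← neg_sub]
    exact Ideal.neg_mem_iff _ |>.2 this
  have hcoe : ∀ (ρ : A ≃+* A) (n : ℕ) (a : A), ((ρ : A →+* A) ^ n) a = (ρ ^ n) a :=
    fun ρ n a => by
      induction n generalizing a with
      | zero => rfl
      | succ n ih => rw [pow_succ, pow_succ, RingHom.mul_def, RingHom.comp_apply, ih]; rfl
  refine ⟨N, hN, fun r => or_iff_not_imp_left.2 fun hinf => ?_⟩
  have hexp : ∀ n : ℤ, (σ ^ (r + N * n)) f = (τ ^ n) ((σ ^ r) f) := fun n => by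
    rw [add_comm, zpow_add, zpow_mul, zpow_natCast, RingAut.mul_apply]
  set g := (σ ^ r) f with hg
  simp only [Set.mem_ofPred_eq, hexp] at hinf ⊢
  refine Set.eq_univ_of_forall fun n => ?_
  change ψ ((τ ^ n) g) = 0
  have hpos : ∀ (ρ : A ≃+* A), (∀ a, ρ a - a ∈ matrixResidueIdeal ψ ^ 2) → ∀ n : ℤ,
      ({k : ℤ | ψ ((ρ ^ k) g) = 0} ∩ Set.Ici 0).Infinite → ψ ((ρ ^ n) g) = 0 := by
    intro ρ hρ n hi
    -- Starting the orbit at `-|n|` puts the possibly negative index `n` within reach of natural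
    -- exponents.
    have h1 := matrix_orbit_eq_zero_of_infinite hp ψ (ρ : A →+* A) hρ
      ((ρ ^ (-(n.natAbs : ℤ))) g) ?_ (n + n.natAbs).toNat
    · rw [hcoe, ← zpow_natCast, ← RingAut.mul_apply, ← zpow_add] at h1
      rwa [show (((n + n.natAbs).toNat : ℤ) + -(n.natAbs : ℤ)) = n by omega] at h1
    · refine Set.Infinite.of_image (fun k : ℕ => (k : ℤ) - n.natAbs) (hi.mono ?_)
      rintro k ⟨hk, hk0⟩
      refine ⟨(k + n.natAbs).toNat, ?_, ?_⟩
      · simp only [Set.mem_ofPred_eq]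
        rw [hcoe, ← zpow_natCast, ← RingAut.mul_apply, ← zpow_add]
        simp only [Set.mem_Ici] at hk0
        rwa [show (((k + n.natAbs).toNat : ℤ) + -(n.natAbs : ℤ)) = k by omega]
      · simp only [Set.mem_Ici] at hk0 ⊢
        omega
  -- Infinitely many zeros accumulate in one direction; the negative one is handled by `τ⁻¹`.
  have hsplit : ({k : ℤ | ψ ((τ ^ k) g) = 0} ∩ Set.Ici 0).Infinite ∨
      ({k : ℤ | ψ ((τ ^ k) g) = 0} ∩ Set.Iic 0).Infinite := by
    by_contra! h
    refine hinf ((h.1.union h.2).subset fun k hk => ?_)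
    rcases le_total 0 k with h0 | h0
    exacts [Or.inl ⟨hk, h0⟩, Or.inr ⟨hk, h0⟩]
  rcases hsplit with h | h
  · exact hpos τ hτ n h
  · have h2 := hpos τ⁻¹ hτ' (-n) ?_
    · rwa [inv_zpow', neg_neg] at h2
    · refine Set.Infinite.of_image (fun k : ℤ => -k) (h.mono ?_)
      rintro k ⟨hk, hk0⟩
      refine ⟨-k, ⟨?_, ?_⟩, neg_neg k⟩
      · simp only [Set.mem_ofPred_eq] at hk ⊢
        rwa [inv_zpow', neg_neg]
      · simpa using hk0

/-! ### Embeddings into matrices over `ℤ_p` -/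

open MvPolynomial in
/-- The points of `ℚ_p ^ r` with algebraically independent coordinates are dense. -/
theorem dense_algebraicIndependent_padic (p : ℕ) [Fact p.Prime] (r : ℕ) :
    Dense {x : Fin r → ℚ_[p] | ∀ q : MvPolynomial (Fin r) ℚ, q ≠ 0 → aeval x q ≠ 0} := by
  have hcount : Countable (MvPolynomial (Fin r) ℚ) := by
    have := (MvPolynomial.cardinalMk_le_max (σ := Fin r) (R := ℚ))
    rw [← Cardinal.mk_le_aleph0_iff]
    refine this.trans ?_
    simp
  -- Baire category: countably many polynomials, each nonvanishing on a dense open set.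
  have h := dense_iInter_of_isOpen (X := Fin r → ℚ_[p])
    (f := fun q : {q : MvPolynomial (Fin r) ℚ // q ≠ 0} => {x | aeval x q.1 ≠ 0})
    (fun q => ?_) (fun q => ?_)
  · convert h using 1
    ext x
    simp
  · have : Continuous fun x : Fin r → ℚ_[p] => aeval x q.1 := by
      simp_rw [aeval_def, ← eval_map]
      exact MvPolynomial.continuous_eval _
    exact isOpen_ne_fun this continuous_const
  · have hcompl : {x : Fin r → ℚ_[p] | aeval x q.1 ≠ 0} = {x | aeval x q.1 = 0}ᶜ := rfl
    rw [hcompl, ← interior_eq_empty_iff_dense_compl, Set.eq_empty_iff_forall_notMem]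
    intro x hx
    obtain ⟨ε, hε, hball⟩ := Metric.mem_nhds_iff.1 (mem_interior_iff_mem_nhds.1 hx)
    have hinf : ∀ i, (Metric.ball (x i) ε).Infinite := fun i =>
      infinite_of_mem_nhds (x i) (Metric.ball_mem_nhds _ hε)
    have hmap : map (algebraMap ℚ ℚ_[p]) q.1 = 0 := by
      refine MvPolynomial.funext_set (fun i => Metric.ball (x i) ε) hinf fun y hy => ?_
      have : y ∈ Metric.ball x ε := by rw [ball_pi x hε]; exact hy
      rw [eval_map, map_zero]
      exact hball this
    exact q.2 (map_injective _ (algebraMap ℚ ℚ_[p]).injective (by rw [hmap, map_zero]))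

open MvPolynomial in
/-- Finitely many elements of a purely transcendental extension of `ℚ` are integral for some
embedding into a field of `p`-adic numbers, `p` odd. -/
theorem exists_padic_embedding (r : ℕ) (E : Finset (FractionRing (MvPolynomial (Fin r) ℚ))) :
    ∃ (p : ℕ) (_ : Fact p.Prime) (ι : FractionRing (MvPolynomial (Fin r) ℚ) →+* ℚ_[p]),
      p ≠ 2 ∧ ∀ e ∈ E, ‖ι e‖ ≤ 1 := by
  obtain ⟨b, hb⟩ := IsLocalization.exist_integer_multiples_of_finset
    (nonZeroDivisors (MvPolynomial (Fin r) ℚ)) E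
  have hb0 : b.1 ≠ 0 := nonZeroDivisors.ne_zero b.2
  choose! num hnum using hb
  obtain ⟨a, ha⟩ : ∃ a : Fin r → ℚ, eval a b.1 ≠ 0 := by
    by_contra! h
    exact hb0 (MvPolynomial.funext fun x => by rw [h x, map_zero])
  -- A prime this large divides no denominator of the values at `a`; the `+ 3` excludes `p = 2`.
  obtain ⟨p, hple, hp⟩ := Nat.exists_infinite_primes
    (∏ e ∈ E, (eval a (num e) / eval a b.1).den + 3)
  have hfact : Fact p.Prime := ⟨hp⟩
  have hden : ∀ e ∈ E, ‖((eval a (num e) / eval a b.1 : ℚ) : ℚ_[p])‖ ≤ 1 := fun e he => by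
    refine Padic.norm_rat_le_one fun hdvd => ?_
    have h1 := Nat.le_of_dvd (Finset.prod_pos fun e _ => Rat.den_pos _)
      (hdvd.trans (Finset.dvd_prod_of_mem (fun e => (eval a (num e) / eval a b.1).den) he))
    omega
  have hcont : ∀ q : MvPolynomial (Fin r) ℚ,
      Continuous fun x : Fin r → ℚ_[p] => aeval x q := fun q => by
    simp_rw [aeval_def, ← eval_map]
    exact MvPolynomial.continuous_eval _
  set a' : Fin r → ℚ_[p] := fun i => (a i : ℚ_[p]) with ha'
  have heval : ∀ q : MvPolynomial (Fin r) ℚ, aeval a' q = ((eval a q : ℚ) : ℚ_[p]) := fun q => by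
    have := aeval_algebraMap_apply ℚ_[p] a q
    rw [aeval_eq_eval, eq_ratCast] at this
    rw [← RingHom.coe_coe, ← this]
    congr 2
  -- The closed unit ball is open, so integrality at `a'` persists at a nearby algebraically
  -- independent point.
  have hev : ∀ᶠ x in nhds a', ∀ e ∈ E, ‖aeval x (num e) / aeval x b.1‖ ≤ 1 := by
    rw [Filter.eventually_all_finset]
    intro e he
    have hc : ContinuousAt (fun x : Fin r → ℚ_[p] => aeval x (num e) / aeval x b.1) a' :=
      (hcont _).continuousAt.div (hcont _).continuousAt (by rw [heval]; exact_mod_cast ha)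
    have hopen : IsOpen (Metric.closedBall (0 : ℚ_[p]) 1) :=
      IsUltrametricDist.isOpen_closedBall _ one_ne_zero
    filter_upwards [hc.preimage_mem_nhds (hopen.mem_nhds (by
      rw [mem_closedBall_zero_iff, heval, heval]
      have := hden e he
      push_cast at this
      exact this))] with x hx
    exact mem_closedBall_zero_iff.1 hx
  obtain ⟨x, hx, hxE⟩ := (dense_algebraicIndependent_padic p r).inter_nhds_nonempty hev
  have hinj : Function.Injective (aeval x : MvPolynomial (Fin r) ℚ →ₐ[ℚ] ℚ_[p]) :=
    (injective_iff_map_eq_zero _).2 fun q hq => by_contra fun h => hx q h hq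
  refine ⟨p, hfact, IsFractionRing.lift (A := MvPolynomial (Fin r) ℚ)
    (g := (aeval x : MvPolynomial (Fin r) ℚ →ₐ[ℚ] ℚ_[p]).toRingHom) hinj, by omega,
    fun e he => ?_⟩
  have h1 := congrArg (IsFractionRing.lift (A := MvPolynomial (Fin r) ℚ)
    (g := (aeval x : MvPolynomial (Fin r) ℚ →ₐ[ℚ] ℚ_[p]).toRingHom) hinj) (hnum e he)
  rw [Algebra.smul_def, map_mul, IsFractionRing.lift_algebraMap,
    IsFractionRing.lift_algebraMap] at h1
  have h2 := hxE e he
  rw [eq_div_of_mul_eq (hx _ hb0) ((mul_comm _ _).trans h1.symm)]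
  exact h2

open TensorProduct in
/-- A finitely generated `ℚ`-algebra whose zero ideal is primary embeds into a matrix ring over a
purely transcendental extension of `ℚ`. -/
theorem exists_injective_matrix (S : Type*) [CommRing S] [Nontrivial S] [Algebra ℚ S]
    [Algebra.FiniteType ℚ S] (hS : ∀ x y : S, x * y = 0 → x = 0 ∨ IsNilpotent y) :
    ∃ (r m : ℕ) (φ : S →+* Matrix (Fin m) (Fin m) (FractionRing (MvPolynomial (Fin r) ℚ))),
      Function.Injective φ := by
  obtain ⟨r, g, hg, hfin⟩ := exists_finite_inj_algHom_of_fg ℚ S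
  let P := MvPolynomial (Fin r) ℚ
  let F := FractionRing P
  let _ : Algebra P S := g.toRingHom.toAlgebra
  have : Module.Finite P S := hfin
  have hinj : Function.Injective (Algebra.TensorProduct.includeRight : S →ₐ[P] F ⊗[P] S) := by
    rw [injective_iff_map_eq_zero]
    intro s hs
    have h1 : TensorProduct.mk P F S 1 s = TensorProduct.mk P F S 1 0 := by
      rw [map_zero]; exact hs
    obtain ⟨c, hc⟩ := (IsLocalizedModule.eq_iff_exists (nonZeroDivisors P)
      (TensorProduct.mk P F S 1)).1 h1
    rw [smul_zero, Submonoid.smul_def, Algebra.smul_def, mul_comm] at hc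
    -- Primarity makes each nonzero `c` in `P` a nonzerodivisor on `S`, since `c` is not nilpotent
    -- there.
    refine (hS _ _ hc).resolve_right fun ⟨k, hk⟩ => ?_
    have h2 : g (c.1 ^ k) = 0 := by rw [map_pow]; exact hk
    exact pow_ne_zero k (nonZeroDivisors.ne_zero c.2) (hg (by rw [h2, map_zero]))
  have : Module.Free F (F ⊗[P] S) := Module.Free.of_divisionRing F (F ⊗[P] S)
  let bas := Module.finBasis F (F ⊗[P] S)
  refine ⟨r, _, (Algebra.leftMulMatrix bas).toRingHom.comp
    (Algebra.TensorProduct.includeRight : S →ₐ[P] F ⊗[P] S).toRingHom, ?_⟩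
  exact (Algebra.leftMulMatrix_injective bas).comp hinj

/-- Only the entries for a finite generating set must be made integral; `ℤ_p` being a subring gives
the rest. -/
theorem exists_matrix_padicInt_lift {A : Type*} [CommRing A] [Algebra.FiniteType ℤ A] {r m : ℕ}
    (φ : A →+* Matrix (Fin m) (Fin m) (FractionRing (MvPolynomial (Fin r) ℚ))) :
    ∃ (p : ℕ) (_ : Fact p.Prime) (ψ : A →+* Matrix (Fin m) (Fin m) ℤ_[p]),
      p ≠ 2 ∧ ∀ a, ψ a = 0 ↔ φ a = 0 := by
  classical
  obtain ⟨s, hs⟩ := (Algebra.FiniteType.out : (⊤ : Subalgebra ℤ A).FG)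
  obtain ⟨p, hp, ι, hp2, hι⟩ := exists_padic_embedding r
    ((s ×ˢ (Finset.univ : Finset (Fin m × Fin m))).image fun x => φ x.1 x.2.1 x.2.2)
  have hnorm : ∀ a i j, ‖ι (φ a i j)‖ ≤ 1 := by
    intro a
    have ha : a ∈ Algebra.adjoin ℤ (s : Set A) := by rw [hs]; trivial
    have hmem : ∀ x : ℚ_[p], ‖x‖ ≤ 1 ↔ x ∈ PadicInt.subring p := fun x => Iff.rfl
    simp_rw [hmem]
    induction ha using Algebra.adjoin_induction with
    | mem x hx =>
      exact fun i j => hι _ (Finset.mem_image.2 ⟨(x, i, j), by simpa using hx, rfl⟩)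
    | algebraMap n =>
      intro i j
      rw [eq_intCast, map_intCast, ← Matrix.diagonal_intCast, Matrix.diagonal_apply]
      split_ifs
      · rw [map_intCast]; exact intCast_mem _ n
      · rw [map_zero]; exact zero_mem _
    | add x y _ _ hx hy =>
      intro i j
      rw [map_add, Matrix.add_apply, map_add]
      exact add_mem (hx i j) (hy i j)
    | mul x y _ _ hx hy =>
      intro i j
      rw [map_mul, Matrix.mul_apply, map_sum]
      exact sum_mem fun l _ => by rw [map_mul]; exact mul_mem (hx i l) (hy l j)
  have hcoe : Function.Injective ((PadicInt.Coe.ringHom (p := p)).mapMatrix (m := Fin m)) :=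
    fun M N h => Matrix.ext fun i j => Subtype.ext (congrFun (congrFun h i) j)
  let Ψ : A →+* Matrix (Fin m) (Fin m) ℚ_[p] := ι.mapMatrix.comp φ
  let f : A → Matrix (Fin m) (Fin m) ℤ_[p] := fun a => Matrix.of fun i j => ⟨_, hnorm a i j⟩
  have hf : ∀ a, (PadicInt.Coe.ringHom (p := p)).mapMatrix (f a) = Ψ a := fun a => rfl
  let ψ : A →+* Matrix (Fin m) (Fin m) ℤ_[p] :=
    { toFun := f
      map_one' := hcoe (by rw [hf, map_one, map_one])
      map_mul' := fun a b => hcoe (by rw [map_mul, hf, hf, hf, map_mul])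
      map_zero' := hcoe (by rw [hf, map_zero, map_zero])
      map_add' := fun a b => hcoe (by rw [map_add, hf, hf, hf, map_add]) }
  refine ⟨p, hp, ψ, hp2, fun a => ?_⟩
  rw [← map_eq_zero_iff _ hcoe]
  change Ψ a = 0 ↔ _
  have hιinj : Function.Injective (ι.mapMatrix (m := Fin m)) :=
    Matrix.map_injective ι.injective
  exact map_eq_zero_iff _ hιinj

theorem finiteOrFullModulo_of_finiteType_rat {A S : Type*} [CommRing A] [Algebra.FiniteType ℤ A]
    [CommRing S] [Nontrivial S] [Algebra ℚ S] [Algebra.FiniteType ℚ S]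
    (hS : ∀ x y : S, x * y = 0 → x = 0 ∨ IsNilpotent y) (ψ : A →+* S) (σ : A ≃+* A) (f : A) :
    FiniteOrFullModulo {n : ℤ | ψ ((σ ^ n) f) = 0} := by
  obtain ⟨r, m, φ, hφ⟩ := exists_injective_matrix S hS
  obtain ⟨p, hp, χ, hp2, hχ⟩ := exists_matrix_padicInt_lift (φ.comp ψ)
  have := finiteOrFullModulo_of_matrix_padicInt hp2 χ σ f
  simp_rw [hχ, RingHom.comp_apply, map_eq_zero_iff φ hφ] at this
  exact this

/-! ### Closure properties of `FiniteOrFullModulo` -/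

/-- Freedom to enlarge the modulus gives two sets a common one. -/
theorem FiniteOrFullModulo.exists_dvd {S : Set ℤ} (hS : FiniteOrFullModulo S) :
    ∃ N : ℕ, 0 < N ∧ ∀ M : ℕ, 0 < M → N ∣ M → ∀ r : ℤ,
      {n : ℤ | r + M * n ∈ S}.Finite ∨ {n : ℤ | r + M * n ∈ S} = Set.univ := by
  obtain ⟨N, hN, h⟩ := hS
  refine ⟨N, hN, ?_⟩
  rintro _ hM ⟨k, rfl⟩ r
  have hk : (k : ℤ) ≠ 0 := by
    rintro hk
    simp [show k = 0 by exact_mod_cast hk] at hM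
  have hpre : {n : ℤ | r + (N * k : ℕ) * n ∈ S} =
      (fun n : ℤ => (k : ℤ) * n) ⁻¹' {n : ℤ | r + N * n ∈ S} := by
    ext n
    simp [mul_assoc]
  rw [hpre]
  rcases h r with h | h
  · exact Or.inl (h.preimage (mul_right_injective₀ hk).injOn)
  · exact Or.inr (by rw [h, Set.preimage_univ])

theorem FiniteOrFullModulo.univ : FiniteOrFullModulo Set.univ :=
  ⟨1, one_pos, fun _ => Or.inr rfl⟩

theorem FiniteOrFullModulo.inter {S T : Set ℤ} (hS : FiniteOrFullModulo S)
    (hT : FiniteOrFullModulo T) : FiniteOrFullModulo (S ∩ T) := by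
  obtain ⟨N, hN, h⟩ := hS.exists_dvd
  obtain ⟨M, hM, h'⟩ := hT.exists_dvd
  refine ⟨N * M, Nat.mul_pos hN hM, fun r => ?_⟩
  rcases h _ (Nat.mul_pos hN hM) (dvd_mul_right _ _) r with h1 | h1
  · exact Or.inl (h1.subset fun n hn => hn.1)
  rcases h' _ (Nat.mul_pos hN hM) (dvd_mul_left _ _) r with h2 | h2
  · exact Or.inl (h2.subset fun n hn => hn.2)
  · exact Or.inr (Set.eq_univ_of_forall fun n =>
      ⟨Set.eq_univ_iff_forall.1 h1 n, Set.eq_univ_iff_forall.1 h2 n⟩)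

theorem FiniteOrFullModulo.biInter {ι : Type*} (s : Finset ι) (S : ι → Set ℤ)
    (hS : ∀ i ∈ s, FiniteOrFullModulo (S i)) : FiniteOrFullModulo (⋂ i ∈ s, S i) := by
  classical
  induction s using Finset.induction_on with
  | empty => simpa using FiniteOrFullModulo.univ
  | insert a s ha ih =>
    rw [Finset.set_biInter_insert]
    exact (hS a (Finset.mem_insert_self _ _)).inter
      (ih fun i hi => hS i (Finset.mem_insert_of_mem hi))

theorem FiniteOrFullModulo.neg {S : Set ℤ} (hS : FiniteOrFullModulo S) :
    FiniteOrFullModulo {n | -n ∈ S} := by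
  obtain ⟨N, hN, h⟩ := hS
  refine ⟨N, hN, fun r => ?_⟩
  have hpre : {n : ℤ | r + N * n ∈ {n | -n ∈ S}} =
      (fun n : ℤ => -n) ⁻¹' {n : ℤ | -r + N * n ∈ S} := by
    ext n
    simp only [Set.mem_ofPred_eq, Set.mem_preimage]
    rw [neg_add, mul_neg]
  rw [hpre]
  rcases h (-r) with h | h
  · exact Or.inl (h.preimage neg_injective.injOn)
  · exact Or.inr (by rw [h, Set.preimage_univ])

theorem FiniteOrFullModulo.twoSidedSML {S : Set ℤ} (hS : FiniteOrFullModulo S) :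
    TwoSidedSML S := by
  classical
  obtain ⟨N, hN, h⟩ := hS
  have hN0 : (N : ℤ) ≠ 0 := by exact_mod_cast hN.ne'
  let full : ℕ → Prop := fun r => {n : ℤ | (r : ℤ) + N * n ∈ S} = Set.univ
  have hclass : ∀ m : ℤ, ∃ r ∈ Finset.range N, ∃ n : ℤ, m = r + N * n := fun m =>
    ⟨(m % N).toNat, by
      have := Int.emod_lt_of_pos m (show (0 : ℤ) < N by exact_mod_cast hN)
      have := Int.emod_nonneg m hN0
      rw [Finset.mem_range]; omega, m / N, by
      rw [Int.toNat_of_nonneg (Int.emod_nonneg m hN0), Int.emod_add_mul_ediv]⟩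
  have hfin : (⋃ r ∈ (Finset.range N).filter fun r => ¬ full r,
      (fun n : ℤ => (r : ℤ) + N * n) '' {n : ℤ | (r : ℤ) + N * n ∈ S}).Finite :=
    Set.Finite.biUnion (Finset.finite_toSet _) fun r hr =>
      ((h r).resolve_right (Finset.mem_filter.1 hr).2).image _
  refine ⟨((Finset.range N).filter full).image fun r : ℕ => ((N : ℤ), (r : ℤ)), hfin.toFinset, ?_⟩
  ext m
  simp only [Finset.mem_image, Set.iUnion_exists, Set.biUnion_and', Set.iUnion_iUnion_eq_right,
    Set.mem_union, Set.mem_iUnion, Set.Finite.coe_toFinset]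
  constructor
  · intro hm
    obtain ⟨r, hr, n, rfl⟩ := hclass m
    by_cases hf : full r
    · exact Or.inl ⟨r, Finset.mem_filter.2 ⟨hr, hf⟩, n, add_comm _ _⟩
    · exact Or.inr ⟨r, Finset.mem_filter.2 ⟨hr, hf⟩, n, hm, rfl⟩
  · rintro (⟨r, hr, n, rfl⟩ | ⟨r, _, n, hn, rfl⟩)
    · have : n ∈ {n : ℤ | (r : ℤ) + N * n ∈ S} := by
        rw [(Finset.mem_filter.1 hr).2]; trivial
      rwa [add_comm]
    · exact hn

/-! ### Descent to finitely generated rings and primary decomposition -/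

open MvPolynomial in
theorem mem_adjoin_int_of_coeffs_subset {ι R : Type*} [CommRing R] (T : Set R)
    (q : MvPolynomial ι R) (hq : ∀ m, q.coeff m ∈ T) :
    q ∈ Algebra.adjoin ℤ (Set.range (X : ι → MvPolynomial ι R) ∪ C '' T) := by
  have hX : ∀ i, X i ∈ Algebra.adjoin ℤ (Set.range (X : ι → MvPolynomial ι R) ∪ C '' T) :=
    fun i => Algebra.subset_adjoin (Or.inl ⟨i, rfl⟩)
  rw [q.as_sum]
  refine sum_mem fun m _ => ?_
  rw [monomial_eq, Finsupp.prod]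
  refine mul_mem (Algebra.subset_adjoin (Or.inr ⟨_, hq m, rfl⟩)) ?_
  exact prod_mem fun i _ => pow_mem (hX i) _

open MvPolynomial in
theorem finite_range_coeff {ι R : Type*} [CommRing R] (q : MvPolynomial ι R) :
    (Set.range fun m => q.coeff m).Finite := by
  classical
  refine ((q.support.image fun m => q.coeff m).finite_toSet.union (Set.finite_singleton 0)).subset ?_
  rintro _ ⟨m, rfl⟩
  by_cases hm : m ∈ q.support
  · exact Or.inl (Finset.mem_coe.2 (Finset.mem_image_of_mem _ hm))
  · exact Or.inr (notMem_support_iff.1 hm)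

open MvPolynomial in
/-- An automorphism of a polynomial ring over a field preserves a finitely generated subring
containing any given polynomial. -/
theorem exists_finite_adjoin_invariant {K : Type*} [Field K] {d : ℕ}
    (σ : MvPolynomial (Fin d) K ≃ₐ[K] MvPolynomial (Fin d) K) (f : MvPolynomial (Fin d) K) :
    ∃ G : Set (MvPolynomial (Fin d) K), G.Finite ∧ f ∈ Algebra.adjoin ℤ G ∧
      (∀ a ∈ Algebra.adjoin ℤ G, σ a ∈ Algebra.adjoin ℤ G) ∧
      ∀ a ∈ Algebra.adjoin ℤ G, σ.symm a ∈ Algebra.adjoin ℤ G := by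
  let coeffSet : MvPolynomial (Fin d) K → Set K := fun q => Set.range fun m => q.coeff m
  -- The variables and these constants generate a stable ring because `σ` fixes constants.
  let T : Set K := coeffSet f ∪ ((⋃ i, coeffSet (σ (X i))) ∪ ⋃ i, coeffSet (σ.symm (X i)))
  have hT : T.Finite := (finite_range_coeff f).union
    ((Set.finite_iUnion fun i => finite_range_coeff _).union
      (Set.finite_iUnion fun i => finite_range_coeff _))
  set G := Set.range (X : Fin d → MvPolynomial (Fin d) K) ∪ C '' T with hG
  have hinv : ∀ ρ : MvPolynomial (Fin d) K ≃ₐ[K] MvPolynomial (Fin d) K,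
      (∀ i, coeffSet (ρ (X i)) ⊆ T) →
      ∀ a ∈ Algebra.adjoin ℤ G, ρ a ∈ Algebra.adjoin ℤ G := by
    intro ρ hρ a ha
    induction ha using Algebra.adjoin_induction with
    | mem x hx =>
      rcases hx with ⟨i, rfl⟩ | ⟨c, hc, rfl⟩
      · exact mem_adjoin_int_of_coeffs_subset T _ fun m => hρ i ⟨m, rfl⟩
      · have : ρ (C c) = C c := ρ.commutes c
        rw [this]
        exact Algebra.subset_adjoin (Or.inr ⟨c, hc, rfl⟩)
    | algebraMap n => rw [eq_intCast, map_intCast]; exact intCast_mem _ n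
    | add x y _ _ hx hy => rw [map_add]; exact add_mem hx hy
    | mul x y _ _ hx hy => rw [map_mul]; exact mul_mem hx hy
  refine ⟨G, (Set.finite_range _).union (hT.image _),
    mem_adjoin_int_of_coeffs_subset T _ fun m => Or.inl ⟨m, rfl⟩, hinv σ fun i => ?_,
    hinv σ.symm fun i => ?_⟩
  · exact (Set.subset_iUnion (fun i => coeffSet (σ (X i))) i).trans
      (Set.subset_union_left.trans Set.subset_union_right)
  · exact (Set.subset_iUnion (fun i => coeffSet (σ.symm (X i))) i).trans
      (Set.subset_union_right.trans Set.subset_union_right)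

theorem finiteType_int_congr (B : Type*) [CommRing B] (inst₁ inst₂ : Algebra ℤ B)
    (h : @Algebra.FiniteType ℤ B _ _ inst₁) : @Algebra.FiniteType ℤ B _ _ inst₂ :=
  Subsingleton.elim inst₁ inst₂ ▸ h

theorem finiteOrFullModulo_mem_of_isPrimary {K : Type*} [Field K] [CharZero K] {d : ℕ}
    (σ : MvPolynomial (Fin d) K ≃ₐ[K] MvPolynomial (Fin d) K)
    (Q : Ideal (MvPolynomial (Fin d) K)) (hQ : Q.IsPrimary) (f : MvPolynomial (Fin d) K) :
    FiniteOrFullModulo {n : ℤ | (σ ^ n) f ∈ Q} := by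
  obtain ⟨G, hGfin, hf, hσ, hσ'⟩ := exists_finite_adjoin_invariant σ f
  obtain ⟨hQtop, hQmul⟩ := Ideal.isPrimary_iff.1 hQ
  have : Nontrivial (MvPolynomial (Fin d) K ⧸ Q) := Ideal.Quotient.nontrivial_iff.2 hQtop
  let S := Algebra.adjoin ℚ (Ideal.Quotient.mk Q '' G)
  have hfg : Algebra.FiniteType ℤ (Algebra.adjoin ℤ G) :=
    (Subalgebra.fg_iff_finiteType _).1 (Subalgebra.fg_def.2 ⟨G, hGfin, rfl⟩)
  have : @Algebra.FiniteType ℤ (Algebra.adjoin ℤ G) _ _ (Ring.toIntAlgebra _) :=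
    finiteType_int_congr (Algebra.adjoin ℤ G) _ _ hfg
  have : Algebra.FiniteType ℚ S :=
    (Subalgebra.fg_iff_finiteType _).1 (Subalgebra.fg_def.2 ⟨_, hGfin.image _, rfl⟩)
  have hmaps : ∀ a : Algebra.adjoin ℤ G, Ideal.Quotient.mk Q a ∈ S := by
    rintro ⟨a, ha⟩
    induction ha using Algebra.adjoin_induction with
    | mem x hx => exact Algebra.subset_adjoin ⟨x, hx, rfl⟩
    | algebraMap n => simp only [eq_intCast, map_intCast]; exact intCast_mem _ n
    | add x y _ _ hx hy => rw [map_add]; exact add_mem hx hy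
    | mul x y _ _ hx hy => rw [map_mul]; exact mul_mem hx hy
  let ψ : Algebra.adjoin ℤ G →+* S :=
    ((Ideal.Quotient.mk Q).comp (Algebra.adjoin ℤ G).val.toRingHom).codRestrict S hmaps
  have hS : ∀ x y : S, x * y = 0 → x = 0 ∨ IsNilpotent y := by
    rintro ⟨x, hx⟩ ⟨y, hy⟩ h
    obtain ⟨x, rfl⟩ := Ideal.Quotient.mk_surjective x
    obtain ⟨y, rfl⟩ := Ideal.Quotient.mk_surjective y
    have h1 : Ideal.Quotient.mk Q (x * y) = 0 := by
      rw [map_mul]; exact congrArg Subtype.val h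
    refine (hQmul (Ideal.Quotient.eq_zero_iff_mem.1 h1)).imp (fun hx => ?_) ?_
    · exact Subtype.ext (Ideal.Quotient.eq_zero_iff_mem.2 hx)
    · rintro ⟨k, hk⟩
      refine ⟨k, Subtype.ext ?_⟩
      change (Ideal.Quotient.mk Q y) ^ k = 0
      rw [← map_pow]
      exact Ideal.Quotient.eq_zero_iff_mem.2 hk
  let σ₀ : Algebra.adjoin ℤ G ≃+* Algebra.adjoin ℤ G :=
    { toFun := fun a => ⟨σ a, hσ a a.2⟩
      invFun := fun a => ⟨σ.symm a, hσ' a a.2⟩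
      left_inv := fun a => Subtype.ext (σ.symm_apply_apply a)
      right_inv := fun a => Subtype.ext (σ.apply_symm_apply a)
      map_mul' := fun a b => Subtype.ext (map_mul σ _ _)
      map_add' := fun a b => Subtype.ext (map_add σ _ _) }
  have hpow : ∀ (n : ℤ) (a : Algebra.adjoin ℤ G),
      (((σ₀ ^ n) a : Algebra.adjoin ℤ G) : MvPolynomial (Fin d) K) = (σ ^ n) a := by
    intro n
    induction n using Int.induction_on with
    | zero => intro a; rfl
    | succ n ih =>
      intro a
      rw [zpow_add_one, zpow_add_one, RingAut.mul_apply, ih, AlgEquiv.mul_apply]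
      rfl
    | pred n ih =>
      intro a
      rw [zpow_sub_one, zpow_sub_one, RingAut.mul_apply, ih, AlgEquiv.mul_apply]
      rfl
  have key := finiteOrFullModulo_of_finiteType_rat hS ψ σ₀ ⟨f, hf⟩
  have hiff : ∀ n : ℤ, ψ ((σ₀ ^ n) ⟨f, hf⟩) = 0 ↔ (σ ^ n) f ∈ Q := fun n => by
    rw [← Ideal.Quotient.eq_zero_iff_mem, ← hpow n ⟨f, hf⟩]
    exact Subtype.ext_iff
  simp_rw [hiff] at key
  exact key

theorem theorem4p1 {K : Type*} [Field K] [CharZero K] (d : ℕ)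
    (σ : MvPolynomial (Fin d) K ≃ₐ[K] MvPolynomial (Fin d) K)
    (I J : Ideal (MvPolynomial (Fin d) K)) :
    TwoSidedSML {n : ℤ |
      (J : Set (MvPolynomial (Fin d) K)) ⊆ (σ ^ n) '' (I : Set (MvPolynomial (Fin d) K))} := by
  obtain ⟨s, hs⟩ := (IsNoetherian.noetherian J : J.FG)
  obtain ⟨t, ht, hprim⟩ := Submodule.isLasker (MvPolynomial (Fin d) K) (MvPolynomial (Fin d) K) I
  -- The sign appears because `σ^n(I)` is the preimage of `I` under `σ^(-n)`.
  have hfull : FiniteOrFullModulo (⋂ f ∈ s, ⋂ Q ∈ t, {n : ℤ | -n ∈ {n : ℤ | (σ ^ n) f ∈ Q}}) :=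
    FiniteOrFullModulo.biInter s _ fun f _ => FiniteOrFullModulo.biInter t _ fun Q hQ =>
      (finiteOrFullModulo_mem_of_isPrimary σ Q (hprim hQ) f).neg
  convert hfull.twoSidedSML using 1
  ext n
  have himage : (σ ^ n) '' (I : Set (MvPolynomial (Fin d) K)) =
      (I.comap (σ ^ (-n)) : Set (MvPolynomial (Fin d) K)) := by
    ext a
    rw [zpow_neg]
    constructor
    · rintro ⟨b, hb, rfl⟩
      change (σ ^ n).symm ((σ ^ n) b) ∈ I
      rwa [AlgEquiv.symm_apply_apply]
    · exact fun ha => ⟨(σ ^ n).symm a, ha, AlgEquiv.apply_symm_apply _ _⟩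
  rw [Set.mem_ofPred_eq, himage, SetLike.coe_subset_coe, ← hs, Submodule.span_le]
  simp only [Set.mem_iInter, Set.mem_ofPred_eq]
  refine forall₂_congr fun f _ => ?_
  change (σ ^ (-n)) f ∈ I ↔ _
  rw [← ht, Submodule.mem_finsetInf]
  rfl
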